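/- Let $\Omega_n=\{0,1\}^n$ with the uniform probability measure $\mu$. For $\mathcal A,\mathcal B\subset\Omega_n$ put $\mathrm{Cov}(\mathcal A,\mathcal B)=\mu(\mathcal A\cap\mathcal B)-\mu(\mathcal A)\mu(\mathcal B)$, and for $1\le k\le n$ let $I_k(\mathcal A)=2\mu(\{x\in\mathcal A: x\oplus e_k\notin\mathcal A\})$ be the influence of the $k$-th variable, where $x\oplus e_k$ is $x$ with $x_k$ replaced by $1-x_k$. The family $\mathcal A$ is increasing if $x\in\mathcal A$ and $x_i\le y_i$ for all $i$ imply $y\in\mathcal A$; it is regular if $I_1(\mathcal A)=\dots=I_n(\mathcal A)$; and it is balanced if $\mu(\mathcal A)=1/2$. Then there is a universal constant $c>0$ such that for every $n\ge 1$, every increasing, regular and balanced family $\mathcal A\subset\Omega_n$, and the majority family $\mathcal B=\{x\in\Omega_n:\sum_{i=1}^n x_i>n/2\}$, $$\mathrm{Cov}(\mathcal A,\mathcal B)\ \ge\ c\,\frac{\sqrt{\log n}}{\sqrt n}.$$ -/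

import Mathlib

namespace DiscreteCube

/-- The discrete cube `{0,1}^n`, with the coordinatewise order (`false < true`), which is
inclusion of subsets of `[n]`. -/
abbrev Cube (n : ℕ) : Type := Fin n → Bool

/-- The uniform probability measure of a family. -/
noncomputable def mu {n : ℕ} (A : Finset (Cube n)) : ℝ := (A.card : ℝ) / 2 ^ n

/-- `x ⊕ e_k`: replace the coordinate `x k` by `1 - x k`. -/
def flip {n : ℕ} (k : Fin n) (x : Cube n) : Cube n := Function.update x k (!x k)

/-- `Cov(A,B) = μ(A ∩ B) - μ(A) μ(B)`. -/
noncomputable def cov {n : ℕ} (A B : Finset (Cube n)) : ℝ := mu (A ∩ B) - mu A * mu B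

/-- The influence `I_k(A) = 2 μ({x ∈ A | x ⊕ e_k ∉ A})`. -/
noncomputable def influence {n : ℕ} (k : Fin n) (A : Finset (Cube n)) : ℝ :=
  2 * mu (A.filter fun x => flip k x ∉ A)

/-- If `S ∈ A` and `S ⊆ T` then `T ∈ A`. -/
def IsIncreasing {n : ℕ} (A : Finset (Cube n)) : Prop := IsUpperSet (A : Set (Cube n))

/-- All influences are equal. -/
def IsRegular {n : ℕ} (A : Finset (Cube n)) : Prop :=
  ∀ i j : Fin n, influence i A = influence j A

def IsBalanced {n : ℕ} (A : Finset (Cube n)) : Prop := mu A = 1 / 2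

/-- The majority family `{x : ∑ x_i > n/2}`. -/
noncomputable def majority (n : ℕ) : Finset (Cube n) :=
  Finset.univ.filter fun x => (n : ℝ) / 2 < ∑ i, if x i then (1 : ℝ) else 0

end DiscreteCube

/-! Let `q` be the average of `1_A` over coordinate permutations. It is a nondecreasing function of
`total`, so some level `a` satisfies `q ≤ a` where `total ≤ 0` and `q ≥ a` where `total > 0`. Hence
`(q - a) * total = |q - a| * |total|`, whose mean is half the total influence, while the covariance
with majority is at least `1/4` of the mean of `|q - a|`. As `|total|` rarely exceeds `M`, of order
`√(n log n)`, the total influence is at most `8 * M * cov` plus a tail (`total_influence_le`). For a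
regular balanced family the total influence is at least `log n / 13`, by the Kahn–Kalai–Linial
argument (`log_le_total_influence`, from `bonami`). Dividing by `M` gives the bound. -/

namespace DiscreteCube
open Finset BigOperators

variable {n : ℕ}

/-! ### Walsh characters and hypercontractivity -/

theorem flip_same (k : Fin n) (x : Cube n) : flip k x k = !x k := by simp [flip]

theorem flip_of_ne {i k : Fin n} (h : i ≠ k) (x : Cube n) : flip k x i = x i := by
  simp [flip, h]

theorem flip_involutive (k : Fin n) : Function.Involutive (flip (n := n) k) := by
  intro x
  simp [flip]

theorem expect_flip (k : Fin n) (f : Cube n → ℝ) : 𝔼 x, f (flip k x) = 𝔼 x, f x :=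
  Fintype.expect_equiv (flip_involutive k).toPerm _ _ fun _ => rfl

/-- The `i`-th coordinate with values in `{-1, 1}`. -/
def sgn (i : Fin n) (x : Cube n) : ℝ := if x i then 1 else -1

theorem sgn_flip_same (i : Fin n) (x : Cube n) : sgn i (flip i x) = -sgn i x := by
  unfold sgn
  rw [flip_same]
  cases x i <;> simp

theorem sgn_flip_of_ne {i k : Fin n} (h : i ≠ k) (x : Cube n) : sgn i (flip k x) = sgn i x := by
  unfold sgn
  rw [flip_of_ne h]

theorem sgn_sq (i : Fin n) (x : Cube n) : sgn i x ^ 2 = 1 := by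
  unfold sgn
  split_ifs <;> norm_num

/-- The Walsh character of a set of coordinates. -/
def chi (S : Finset (Fin n)) (x : Cube n) : ℝ := ∏ i ∈ S, sgn i x

theorem chi_flip_of_notMem {i : Fin n} {S : Finset (Fin n)} (h : i ∉ S) (x : Cube n) :
    chi S (flip i x) = chi S x :=
  prod_congr rfl fun j hj => sgn_flip_of_ne (by rintro rfl; exact h hj) x

theorem chi_insert {i : Fin n} {S : Finset (Fin n)} (h : i ∉ S) (x : Cube n) :
    chi (insert i S) x = sgn i x * chi S x := prod_insert h

theorem chi_flip_of_mem {i : Fin n} {S : Finset (Fin n)} (h : i ∈ S) (x : Cube n) :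
    chi S (flip i x) = -chi S x := by
  rw [← insert_erase h, chi_insert (notMem_erase i S), chi_insert (notMem_erase i S),
    sgn_flip_same, chi_flip_of_notMem (notMem_erase i S), neg_mul]

/-- The fourth moment form of the Bonami hypercontractive inequality. -/
theorem bonami (U : Finset (Fin n)) (a : Finset (Fin n) → ℝ) :
    𝔼 x, (∑ S ∈ U.powerset, a S * chi S x) ^ 4 ≤ (∑ S ∈ U.powerset, 3 ^ #S * a S ^ 2) ^ 2 := by
  induction U using Finset.induction_on generalizing a with
  | empty =>
    simp only [powerset_empty, sum_singleton, chi, prod_empty, card_empty]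
    rw [Fintype.expect_const]
    exact le_of_eq (by ring)
  | insert i U hi ih =>
    set G : Cube n → ℝ := fun x => ∑ S ∈ U.powerset, a S * chi S x with hG
    set H : Cube n → ℝ := fun x => ∑ S ∈ U.powerset, a (insert i S) * chi S x with hH
    set g := ∑ S ∈ U.powerset, 3 ^ #S * a S ^ 2 with hg
    set h := ∑ S ∈ U.powerset, 3 ^ #S * a (insert i S) ^ 2 with hh
    have notMem {S} (hS : S ∈ U.powerset) : i ∉ S := fun hiS => hi (mem_powerset.1 hS hiS)
    have hF (x : Cube n) : ∑ S ∈ (insert i U).powerset, a S * chi S x = G x + sgn i x * H x := by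
      rw [sum_powerset_insert hi, hG, hH, mul_sum]
      congr 1
      refine sum_congr rfl fun S hS => ?_
      rw [chi_insert (notMem hS)]
      ring
    have hR : ∑ S ∈ (insert i U).powerset, 3 ^ #S * a S ^ 2 = g + 3 * h := by
      rw [sum_powerset_insert hi, hg, hh, mul_sum]
      congr 1
      refine sum_congr rfl fun S hS => ?_
      rw [card_insert_of_notMem (notMem hS)]
      ring
    have hGf (x : Cube n) : G (flip i x) = G x :=
      sum_congr rfl fun S hS => by rw [chi_flip_of_notMem (notMem hS)]
    have hHf (x : Cube n) : H (flip i x) = H x :=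
      sum_congr rfl fun S hS => by rw [chi_flip_of_notMem (notMem hS)]
    have hg4 : 𝔼 x, G x ^ 4 ≤ g ^ 2 := ih a
    have hh4 : 𝔼 x, H x ^ 4 ≤ h ^ 2 := ih fun S => a (insert i S)
    have hg0 : 0 ≤ g := sum_nonneg fun S _ => by positivity
    have hh0 : 0 ≤ h := sum_nonneg fun S _ => by positivity
    have hcross : 𝔼 x, G x ^ 2 * H x ^ 2 ≤ g * h := by
      refine le_of_sq_le_sq ?_ (mul_nonneg hg0 hh0)
      calc (𝔼 x, G x ^ 2 * H x ^ 2) ^ 2 ≤ (𝔼 x, (G x ^ 2) ^ 2) * 𝔼 x, (H x ^ 2) ^ 2 :=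
            expect_mul_sq_le_sq_mul_sq _ _ _
        _ = (𝔼 x, G x ^ 4) * 𝔼 x, H x ^ 4 := by simp only [← pow_mul, Nat.reduceMul]
        _ ≤ g ^ 2 * h ^ 2 := mul_le_mul hg4 hh4 (expect_nonneg fun x _ => by positivity) (sq_nonneg g)
        _ = (g * h) ^ 2 := by ring
    -- Averaging over the flip of `i` removes the odd powers of `sgn i`.
    have hexp : 𝔼 x, (G x + sgn i x * H x) ^ 4
        = 𝔼 x, G x ^ 4 + 6 * 𝔼 x, G x ^ 2 * H x ^ 2 + 𝔼 x, H x ^ 4 := by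
      have h1 := expect_flip i fun x => (G x + sgn i x * H x) ^ 4
      simp only [hGf, hHf, sgn_flip_same] at h1
      have h2 : 𝔼 x, (G x + -sgn i x * H x) ^ 4 + 𝔼 x, (G x + sgn i x * H x) ^ 4
          = 2 * (𝔼 x, G x ^ 4 + 6 * 𝔼 x, G x ^ 2 * H x ^ 2 + 𝔼 x, H x ^ 4) := by
        simp only [mul_expect, ← expect_add_distrib]
        refine expect_congr rfl fun x _ => ?_
        have := sgn_sq i x
        linear_combination (12 * G x ^ 2 * H x ^ 2 + 2 * H x ^ 4 * (sgn i x ^ 2 + 1)) * this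
      linarith
    simp only [hF]
    rw [hR, hexp]
    nlinarith [mul_nonneg hg0 hh0, sq_nonneg h]

/-! ### Fourier–Walsh expansion and noise -/

/-- The Fourier–Walsh coefficients of a function on the cube. -/
noncomputable def coeff (f : Cube n → ℝ) (S : Finset (Fin n)) : ℝ := 𝔼 x, f x * chi S x

theorem sum_chi_mul_chi (x y : Cube n) :
    ∑ S, chi S x * chi S y = if x = y then (2 : ℝ) ^ n else 0 := by
  have h : ∑ S, chi S x * chi S y = ∏ i : Fin n, (1 + sgn i x * sgn i y) := by
    rw [prod_one_add, powerset_univ]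
    simp only [chi, prod_mul_distrib]
  rw [h]
  split_ifs with hxy
  · subst hxy
    simp only [← sq, sgn_sq]
    norm_num
  · obtain ⟨i, hi⟩ := Function.ne_iff.1 hxy
    refine prod_eq_zero (mem_univ i) ?_
    unfold sgn
    revert hi
    cases x i <;> cases y i <;> simp

theorem fourier_expansion (f : Cube n → ℝ) (x : Cube n) : ∑ S, coeff f S * chi S x = f x := by
  simp only [coeff, expect_mul, mul_assoc]
  rw [← expect_sum_comm]
  simp only [← mul_sum, sum_chi_mul_chi]
  rw [Fintype.expect_eq_sum_div_card]
  simp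

theorem parseval (f : Cube n → ℝ) : ∑ S, coeff f S ^ 2 = 𝔼 x, f x ^ 2 := by
  have h (x : Cube n) : f x ^ 2 = ∑ S, coeff f S * (f x * chi S x) := by
    conv_lhs => rw [sq]; arg 2; rw [← fourier_expansion f x]
    rw [mul_sum]
    exact sum_congr rfl fun S _ => by ring
  simp only [h]
  rw [expect_sum_comm]
  refine sum_congr rfl fun S _ => ?_
  rw [← mul_expect, sq]
  rfl

theorem coeff_sub_flip (f : Cube n → ℝ) (i : Fin n) (S : Finset (Fin n)) :
    coeff (fun x => f x - f (flip i x)) S = if i ∈ S then 2 * coeff f S else 0 := by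
  have h := expect_flip i fun x => f x * chi S (flip i x)
  simp only [flip_involutive i _] at h
  simp only [coeff, sub_mul, expect_sub_distrib]
  rw [h]
  split_ifs with hi
  · simp only [chi_flip_of_mem hi, mul_neg, expect_neg_distrib]
    ring
  · simp only [chi_flip_of_notMem hi, sub_self]

/-- A function with values in `{-1, 0, 1}` has small noisy energy if its support is small. -/
theorem noise_energy_sq_le (g : Cube n → ℝ) (hg : ∀ x, g x = -1 ∨ g x = 0 ∨ g x = 1) :
    (∑ S, (1 / 3 : ℝ) ^ #S * coeff g S ^ 2) ^ 2 ≤ (𝔼 x, g x ^ 2) ^ 3 := by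
  set W := ∑ S, (1 / 3 : ℝ) ^ #S * coeff g S ^ 2 with hW
  set p := 𝔼 x, g x ^ 2 with hp
  set F : Cube n → ℝ := fun x => ∑ S, ((1 / 3 : ℝ) ^ #S * coeff g S) * chi S x with hF
  have hp0 : 0 ≤ p := expect_nonneg fun x _ => sq_nonneg _
  have hW0 : 0 ≤ W := sum_nonneg fun S _ => by positivity
  -- `g ^ 3 = g`, so a factor `g ^ 2` is free; it makes each of the two Cauchy–Schwarz steps below
  -- gain from the small support.
  have hWF : W = 𝔼 x, g x * (g x ^ 2 * F x) := by
    have h1 (x : Cube n) : g x * (g x ^ 2 * F x)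
        = ∑ S, ((1 / 3 : ℝ) ^ #S * coeff g S) * (g x * chi S x) := by
      have : g x * (g x ^ 2 * F x) = g x * F x := by
        rcases hg x with h | h | h <;> rw [h] <;> ring
      rw [this, hF, mul_sum]
      exact sum_congr rfl fun S _ => by ring
    simp only [h1]
    rw [expect_sum_comm]
    refine sum_congr rfl fun S _ => ?_
    rw [← mul_expect, ← coeff]
    ring
  -- The weight `3 ^ #S` in `bonami` cancels one of the two factors `(1 / 3) ^ #S`.
  have hF4 : 𝔼 x, F x ^ 4 ≤ W ^ 2 := by
    have h := bonami univ fun S => (1 / 3 : ℝ) ^ #S * coeff g S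
    rw [powerset_univ] at h
    refine h.trans (le_of_eq ?_)
    rw [hW]
    congr 1
    refine sum_congr rfl fun S _ => ?_
    have : (3 : ℝ) ^ #S * (1 / 3) ^ #S = 1 := by rw [← mul_pow]; norm_num
    linear_combination ((1 / 3 : ℝ) ^ #S * coeff g S ^ 2) * this
  have h1 : W ^ 2 ≤ p * 𝔼 x, g x ^ 2 * F x ^ 2 := by
    rw [hWF]
    refine (expect_mul_sq_le_sq_mul_sq _ _ _).trans (le_of_eq ?_)
    congr 1
    refine expect_congr rfl fun x _ => ?_
    rcases hg x with h | h | h <;> rw [h] <;> ring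
  have h2 : (𝔼 x, g x ^ 2 * F x ^ 2) ^ 2 ≤ p * W ^ 2 := by
    refine (expect_mul_sq_le_sq_mul_sq _ _ _).trans ?_
    have e1 : 𝔼 x, (g x ^ 2) ^ 2 = p := expect_congr rfl fun x _ => by
      rcases hg x with h | h | h <;> rw [h] <;> ring
    have e2 : 𝔼 x, (F x ^ 2) ^ 2 = 𝔼 x, F x ^ 4 := expect_congr rfl fun x _ => by ring
    rw [e1, e2]
    exact mul_le_mul_of_nonneg_left hF4 hp0
  have h3 : W ^ 2 * W ^ 2 ≤ p ^ 3 * W ^ 2 := by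
    calc W ^ 2 * W ^ 2 ≤ (p * 𝔼 x, g x ^ 2 * F x ^ 2) * (p * 𝔼 x, g x ^ 2 * F x ^ 2) :=
          mul_self_le_mul_self (sq_nonneg W) h1
      _ = p ^ 2 * (𝔼 x, g x ^ 2 * F x ^ 2) ^ 2 := by ring
      _ ≤ p ^ 2 * (p * W ^ 2) := mul_le_mul_of_nonneg_left h2 (sq_nonneg p)
      _ = p ^ 3 * W ^ 2 := by ring
  rcases hW0.eq_or_lt with h0 | h0
  · rw [show W = 0 from h0.symm, zero_pow two_ne_zero]
    exact pow_nonneg hp0 3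
  · exact le_of_mul_le_mul_right h3 (by positivity)

/-! ### Influences and the logarithmic lower bound -/

/-- The indicator function of a family. -/
def ind (A : Finset (Cube n)) (x : Cube n) : ℝ := if x ∈ A then 1 else 0

theorem mu_eq_expect (A : Finset (Cube n)) : mu A = 𝔼 x, ind A x := by
  rw [Fintype.expect_eq_sum_div_card]
  simp [mu, ind]

theorem influence_eq_expect (A : Finset (Cube n)) (i : Fin n) :
    influence i A = 𝔼 x, (ind A x - ind A (flip i x)) ^ 2 := by
  have h := expect_flip i fun x => ind (A.filter fun x => flip i x ∉ A) x
  have h2 : 𝔼 x, (ind A x - ind A (flip i x)) ^ 2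
      = 𝔼 x, ind (A.filter fun x => flip i x ∉ A) (flip i x)
        + 𝔼 x, ind (A.filter fun x => flip i x ∉ A) x := by
    rw [← expect_add_distrib]
    refine expect_congr rfl fun x _ => ?_
    simp only [ind, mem_filter, flip_involutive i x]
    by_cases h1 : x ∈ A <;> by_cases h2 : flip i x ∈ A <;> simp [h1, h2]
  rw [h2, h, influence, mu_eq_expect]
  ring

theorem influence_eq_sum_coeff (A : Finset (Cube n)) (i : Fin n) :
    influence i A = ∑ S, if i ∈ S then 4 * coeff (ind A) S ^ 2 else 0 := by
  rw [influence_eq_expect, ← parseval]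
  refine sum_congr rfl fun S _ => ?_
  rw [coeff_sub_flip]
  split_ifs <;> ring

theorem sum_influence (A : Finset (Cube n)) :
    ∑ i, influence i A = ∑ S, 4 * #S * coeff (ind A) S ^ 2 := by
  simp only [influence_eq_sum_coeff]
  rw [sum_comm]
  refine sum_congr rfl fun S _ => ?_
  rw [sum_ite_mem, univ_inter, sum_const, nsmul_eq_mul]
  ring

theorem noisy_influence_sq_le (A : Finset (Cube n)) (i : Fin n) :
    (∑ S, if i ∈ S then (1 / 3 : ℝ) ^ #S * (4 * coeff (ind A) S ^ 2) else 0) ^ 2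
      ≤ influence i A ^ 3 := by
  have h := noise_energy_sq_le (fun x => ind A x - ind A (flip i x)) (fun x => by
    unfold ind
    by_cases h1 : x ∈ A <;> by_cases h2 : flip i x ∈ A <;> simp [h1, h2])
  rw [← influence_eq_expect] at h
  refine le_trans (le_of_eq ?_) h
  congr 1
  refine sum_congr rfl fun S _ => ?_
  rw [coeff_sub_flip]
  split_ifs <;> ring

/-- Markov's inequality term by term: levels `m ≤ 2 * K` satisfy `(1 / 3) ^ m ≥ exp (-4 * K)`, and
for higher levels the left side is nonpositive. -/
theorem exp_mul_sub_le {K c : ℝ} {m : ℕ} (hK : 1 ≤ K) (hm : (1 : ℝ) ≤ m) (hc : 0 ≤ c) :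
    Real.exp (-4 * K) * (4 * c - 4 * m * c / (2 * K)) ≤ 4 * m * ((1 / 3 : ℝ) ^ m * c) := by
  rcases le_or_gt (m : ℝ) (2 * K) with h | h
  · have he : Real.exp (-4 * K) ≤ (1 / 3 : ℝ) ^ m := by
      calc Real.exp (-4 * K) ≤ Real.exp (m * (-2)) := Real.exp_le_exp.2 (by linarith)
        _ = Real.exp (-2) ^ m := Real.exp_nat_mul _ _
        _ ≤ (1 / 3 : ℝ) ^ m := by
          refine pow_le_pow_left₀ (Real.exp_pos _).le ?_ _
          rw [Real.exp_neg, one_div]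
          exact inv_anti₀ (by norm_num) (by linarith [Real.add_one_le_exp (2 : ℝ)])
    calc Real.exp (-4 * K) * (4 * c - 4 * m * c / (2 * K))
        ≤ Real.exp (-4 * K) * (4 * c) := by
          refine mul_le_mul_of_nonneg_left ?_ (Real.exp_pos _).le
          have : 0 ≤ 4 * m * c / (2 * K) := by positivity
          linarith
      _ ≤ (1 / 3 : ℝ) ^ m * (4 * c) := mul_le_mul_of_nonneg_right he (by positivity)
      _ ≤ m * ((1 / 3 : ℝ) ^ m * (4 * c)) := le_mul_of_one_le_left (by positivity) hm
      _ = _ := by ring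
  · have h1 : 4 * c ≤ 4 * m * c / (2 * K) := by
      rw [le_div_iff₀ (by linarith)]
      nlinarith
    calc _ ≤ (0 : ℝ) := mul_nonpos_of_nonneg_of_nonpos (Real.exp_pos _).le (by linarith)
      _ ≤ _ := by positivity

theorem log_le_of_mul_exp_sq_le {K t : ℝ} (ht : 0 < t) (hK : 1 ≤ K)
    (h : t * Real.exp (-4 * K) ^ 2 ≤ 4 * K ^ 3) : Real.log t ≤ 13 * K := by
  rw [Real.log_le_iff_le_exp ht]
  have h1 := Real.add_one_le_exp K
  have h2 : (4 : ℝ) ≤ Real.exp (2 * K) := by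
    rw [two_mul, Real.exp_add]
    nlinarith
  have h3 : K ^ 3 ≤ Real.exp (3 * K) := by
    rw [show 3 * K = (3 : ℕ) * K by norm_num, Real.exp_nat_mul]
    exact pow_le_pow_left₀ (by linarith) (by linarith) 3
  have h4 : Real.exp (-4 * K) ^ 2 * Real.exp (8 * K) = 1 := by
    rw [sq, ← Real.exp_add, ← Real.exp_add, ← Real.exp_zero]
    ring_nf
  calc t = t * Real.exp (-4 * K) ^ 2 * Real.exp (8 * K) := by rw [mul_assoc, h4, mul_one]
    _ ≤ 4 * K ^ 3 * Real.exp (8 * K) := mul_le_mul_of_nonneg_right h (Real.exp_pos _).le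
    _ ≤ Real.exp (2 * K) * Real.exp (3 * K) * Real.exp (8 * K) := by gcongr
    _ = Real.exp (13 * K) := by
      rw [← Real.exp_add, ← Real.exp_add]
      ring_nf

/-- A balanced family with equal influences has total influence of order at least `log n`. -/
theorem log_le_total_influence (A : Finset (Cube n)) (hr : IsRegular A) (hb : IsBalanced A) :
    Real.log n ≤ 13 * ∑ i, influence i A := by
  rcases Nat.eq_zero_or_pos n with rfl | hn
  · simp
  set K := ∑ i, influence i A with hK
  have hnR : (0 : ℝ) < n := Nat.cast_pos.2 hn
  let i₀ : Fin n := ⟨0, hn⟩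
  set δ := influence i₀ A with hδ
  have hKδ : K = n * δ := by
    rw [hK, sum_congr rfl fun i _ => hr i i₀]
    simp [hδ]
  have hδ0 : 0 ≤ δ := by
    rw [hδ, influence_eq_expect]
    exact expect_nonneg fun x _ => sq_nonneg _
  set c : Finset (Fin n) → ℝ := fun S => coeff (ind A) S ^ 2 with hc
  have hc0 (S) : 0 ≤ c S := sq_nonneg _
  have hKs : K = ∑ S, 4 * #S * c S := sum_influence A
  have hVar : ∑ S ∈ univ.erase ∅, c S = 1 / 4 := by
    have h1 : ∑ S, c S = 1 / 2 := by
      rw [hc, parseval, ← show mu A = 1 / 2 from hb, mu_eq_expect]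
      exact expect_congr rfl fun x _ => by unfold ind; split_ifs <;> norm_num
    have h2 : c ∅ = 1 / 4 := by
      have : coeff (ind A) ∅ = 1 / 2 := by
        rw [← show mu A = 1 / 2 from hb, mu_eq_expect]
        simp [coeff, chi]
      simp only [hc, this]
      norm_num
    have h3 := sum_erase_add univ c (mem_univ (∅ : Finset (Fin n)))
    linarith
  have hcard {S : Finset (Fin n)} (hS : S ∈ univ.erase ∅) : (1 : ℝ) ≤ #S := by
    exact_mod_cast card_pos.2 (nonempty_iff_ne_empty.2 (ne_of_mem_erase hS))
  have hK1 : 1 ≤ K := by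
    calc (1 : ℝ) = ∑ S ∈ univ.erase ∅, 4 * c S := by rw [← mul_sum, hVar]; norm_num
      _ ≤ ∑ S ∈ univ.erase ∅, 4 * #S * c S := sum_le_sum fun S hS => by
          nlinarith [hcard hS, hc0 S]
      _ ≤ ∑ S, 4 * #S * c S := sum_le_sum_of_subset_of_nonneg (erase_subset _ _)
          fun S _ _ => by have := hc0 S; positivity
      _ = K := hKs.symm
  set Q := ∑ S, 4 * #S * ((1 / 3 : ℝ) ^ #S * c S) with hQ
  have hQle : Q ≤ n * Real.sqrt (δ ^ 3) := by
    have h1 : Q = ∑ i : Fin n, ∑ S, if i ∈ S then (1 / 3 : ℝ) ^ #S * (4 * c S) else 0 := by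
      rw [sum_comm, hQ]
      refine sum_congr rfl fun S _ => ?_
      rw [sum_ite_mem, univ_inter, sum_const, nsmul_eq_mul]
      ring
    rw [h1]
    calc _ ≤ ∑ i : Fin n, Real.sqrt (δ ^ 3) := sum_le_sum fun i _ => by
          refine Real.le_sqrt_of_sq_le ?_
          rw [hδ, hr i₀ i]
          exact noisy_influence_sq_le A i
      _ = _ := by simp
  have hQge : Real.exp (-4 * K) / 2 ≤ Q := by
    have hKe : ∑ S ∈ univ.erase ∅, 4 * #S * c S ≤ K := by
      rw [hKs]
      exact sum_le_sum_of_subset_of_nonneg (erase_subset _ _)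
        fun S _ _ => by have := hc0 S; positivity
    -- The nonempty levels carry `4 * (1 / 4) = 1`, and the subtracted part is at most `K / (2 *
    -- K)`.
    have hhalf : 1 / 2 ≤ ∑ S ∈ univ.erase (∅ : Finset (Fin n)),
        (4 * c S - 4 * #S * c S / (2 * K)) := by
      rw [sum_sub_distrib, ← mul_sum, ← sum_div, hVar]
      have : (∑ S ∈ univ.erase ∅, 4 * #S * c S) / (2 * K) ≤ 1 / 2 := by
        rw [div_le_iff₀ (by linarith)]
        linarith
      linarith
    calc Real.exp (-4 * K) / 2 = Real.exp (-4 * K) * (1 / 2) := by ring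
      _ ≤ Real.exp (-4 * K) * ∑ S ∈ univ.erase (∅ : Finset (Fin n)),
          (4 * c S - 4 * #S * c S / (2 * K)) :=
          mul_le_mul_of_nonneg_left hhalf (Real.exp_pos _).le
      _ ≤ ∑ S ∈ univ.erase ∅, 4 * #S * ((1 / 3 : ℝ) ^ #S * c S) := by
          rw [mul_sum]
          exact sum_le_sum fun S hS => exp_mul_sub_le hK1 (hcard hS) (hc0 S)
      _ ≤ Q := sum_le_sum_of_subset_of_nonneg (erase_subset _ _)
          fun S _ _ => by have := hc0 S; positivity
  -- Regularity enters here: `n * δ = K` turns `n ^ 2 * δ ^ 3` into `K ^ 3 / n`.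
  have hmain : (n : ℝ) * Real.exp (-4 * K) ^ 2 ≤ 4 * K ^ 3 := by
    have h1 : (Real.exp (-4 * K) / 2) ^ 2 ≤ (n * Real.sqrt (δ ^ 3)) ^ 2 :=
      pow_le_pow_left₀ (by positivity) (hQge.trans hQle) 2
    rw [mul_pow, Real.sq_sqrt (by positivity)] at h1
    rw [hKδ] at h1 ⊢
    nlinarith
  exact log_le_of_mul_exp_sq_le hnR hK1 hmain

/-! ### Symmetrization over coordinate permutations -/

/-- The sum of the `±1`-valued coordinates. -/
def total (x : Cube n) : ℝ := ∑ i, sgn i x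

theorem total_eq_card (x : Cube n) : total x = 2 * #{i | x i = true} - n := by
  have h (i : Fin n) : sgn i x = 2 * (if x i = true then 1 else 0) - 1 := by
    unfold sgn
    split_ifs <;> norm_num
  simp only [total, h, sum_sub_distrib, ← mul_sum, sum_boole, sum_const, card_univ,
    Fintype.card_fin, nsmul_eq_mul, mul_one]

theorem mem_majority (x : Cube n) : x ∈ majority n ↔ 0 < total x := by
  rw [total_eq_card]
  simp only [majority, mem_filter, mem_univ, true_and, sum_boole]
  constructor <;> intro h <;> linarith

theorem total_comp_perm (σ : Equiv.Perm (Fin n)) (x : Cube n) : total (x ∘ σ) = total x :=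
  Equiv.sum_comp σ fun i => sgn i x

theorem abs_total_le (x : Cube n) : |total x| ≤ n := by
  calc |total x| ≤ ∑ i, |sgn i x| := abs_sum_le_sum_abs _ _
    _ = ∑ i : Fin n, (1 : ℝ) := sum_congr rfl fun i _ => by
      unfold sgn
      split_ifs <;> norm_num
    _ = n := by simp

/-- `x` has no more ones than `y`, so a permutation can move them all inside the ones of `y`. -/
theorem exists_perm_comp_le {x y : Cube n} (h : total x ≤ total y) :
    ∃ σ : Equiv.Perm (Fin n), x ∘ σ ≤ y := by
  rw [total_eq_card, total_eq_card] at h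
  have hc : #{i | x i = true} ≤ #{i | y i = true} := by
    have : (#{i | x i = true} : ℝ) ≤ #{i | y i = true} := by linarith
    exact_mod_cast this
  obtain ⟨t, ht, hct⟩ := exists_subset_card_eq hc
  let e : {i // i ∈ t} ≃ {i // x i = true} :=
    Fintype.equivOfCardEq (by rw [Fintype.card_coe, hct, Fintype.card_subtype])
  refine ⟨e.extendSubtype, fun i => ?_⟩
  by_cases hi : i ∈ t
  · have : y i = true := (mem_filter.1 (ht hi)).2
    rw [this]
    exact Bool.le_true _
  · have := e.extendSubtype_not_mem i hi
    rw [Function.comp_apply, Bool.eq_false_iff.2 this]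
    exact Bool.false_le _

theorem expect_comp_perm (σ : Equiv.Perm (Fin n)) (f : Cube n → ℝ) :
    𝔼 x : Cube n, f (x ∘ σ) = 𝔼 x, f x :=
  Fintype.expect_equiv (Equiv.arrowCongr σ.symm (Equiv.refl Bool)) _ _ fun _ => rfl

/-- The average of a function over all permutations of the coordinates. -/
noncomputable def symmetrize (f : Cube n → ℝ) (x : Cube n) : ℝ :=
  𝔼 σ : Equiv.Perm (Fin n), f (x ∘ σ)

theorem symmetrize_le_of_total_le {A : Finset (Cube n)} (hA : IsIncreasing A) {x y : Cube n}
    (h : total x ≤ total y) : symmetrize (ind A) x ≤ symmetrize (ind A) y := by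
  obtain ⟨σ, hσ⟩ := exists_perm_comp_le h
  have h1 : symmetrize (ind A) x = 𝔼 τ : Equiv.Perm (Fin n), ind A ((x ∘ σ) ∘ τ) :=
    (Fintype.expect_equiv (Equiv.mulLeft σ) _ _ fun _ => rfl).symm
  rw [h1]
  refine expect_le_expect fun τ _ => ?_
  have hle : (x ∘ σ) ∘ τ ≤ y ∘ τ := fun i => hσ (τ i)
  unfold ind
  split_ifs with h2 h3
  · exact le_rfl
  · exact absurd (hA hle h2) h3
  · exact zero_le_one
  · exact le_rfl

theorem expect_symmetrize_mul (f h : Cube n → ℝ)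
    (hh : ∀ (σ : Equiv.Perm (Fin n)) x, h (x ∘ σ) = h x) :
    𝔼 x, symmetrize f x * h x = 𝔼 x, f x * h x := by
  simp only [symmetrize, expect_mul]
  rw [expect_comm]
  have (σ : Equiv.Perm (Fin n)) : 𝔼 x : Cube n, f (x ∘ σ) * h x = 𝔼 x, f x * h x := by
    rw [← expect_comp_perm σ fun x => f x * h x]
    simp only [hh]
  simp only [this]
  exact Fintype.expect_const _

theorem symmetrize_ind_mem_Icc (A : Finset (Cube n)) (x : Cube n) :
    symmetrize (ind A) x ∈ Set.Icc (0 : ℝ) 1 := by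
  have h (x) : 0 ≤ ind A x ∧ ind A x ≤ 1 := by
    unfold ind
    split_ifs <;> norm_num
  exact ⟨expect_nonneg fun _ _ => (h _).1, expect_le univ_nonempty fun _ _ => (h _).2⟩

/-- The symmetrization of an increasing family crosses some level in `[0, 1]` at the middle layer. -/
theorem exists_threshold {A : Finset (Cube n)} (hA : IsIncreasing A) :
    ∃ a ∈ Set.Icc (0 : ℝ) 1, (∀ x, total x ≤ 0 → symmetrize (ind A) x ≤ a) ∧
      ∀ x, 0 < total x → a ≤ symmetrize (ind A) x := by
  have hne : ({x | total x ≤ 0} : Finset (Cube n)).Nonempty :=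
    ⟨fun _ => false, by simp [mem_filter, total_eq_card]⟩
  obtain ⟨z, hz, hmax⟩ := exists_max_image _ (symmetrize (ind A)) hne
  simp only [mem_filter, mem_univ, true_and] at hz hmax
  exact ⟨_, symmetrize_ind_mem_Icc A z, hmax,
    fun x hx => symmetrize_le_of_total_le hA (hz.trans hx.le)⟩

/-! ### Covariance with majority -/

theorem expect_compl (f : Cube n → ℝ) : 𝔼 x : Cube n, f (fun i => !x i) = 𝔼 x, f x := by
  have h : Function.Involutive fun (x : Cube n) i => !x i := fun x => by simp
  exact Fintype.expect_equiv h.toPerm _ _ fun _ => rfl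

theorem total_compl (x : Cube n) : total (fun i => !x i) = -total x := by
  rw [total, total, ← sum_neg_distrib]
  refine sum_congr rfl fun i _ => ?_
  unfold sgn
  cases h : x i <;> simp [h]

theorem expect_total : 𝔼 x : Cube n, total x = 0 := by
  have h := expect_compl (total (n := n))
  simp only [total_compl, expect_neg_distrib] at h
  linarith

theorem total_flip (i : Fin n) (x : Cube n) : total (flip i x) = total x - 2 * sgn i x := by
  rw [total, total, ← add_sum_erase _ _ (mem_univ i), ← add_sum_erase _ _ (mem_univ i),
    sgn_flip_same, sum_congr rfl fun j hj => sgn_flip_of_ne (ne_of_mem_erase hj) x]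
  ring

/-- Complementation exchanges the two strict halves, and the tie layer has measure at most `1/2`
because flipping one coordinate leaves it. -/
theorem mu_majority_mem_Icc (hn : 0 < n) : mu (majority n) ∈ Set.Icc (1 / 4 : ℝ) (1 / 2) := by
  set P : Cube n → ℝ := fun x => if 0 < total x then 1 else 0 with hP
  set N : Cube n → ℝ := fun x => if total x < 0 then 1 else 0 with hN
  set Z : Cube n → ℝ := fun x => if total x = 0 then 1 else 0 with hZ
  have hmu : mu (majority n) = 𝔼 x, P x := by
    rw [mu_eq_expect]
    exact expect_congr rfl fun x _ => by simp only [ind, mem_majority, hP]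
  have h1 : 𝔼 x, N x = 𝔼 x, P x := by
    rw [← expect_compl P]
    refine expect_congr rfl fun x _ => ?_
    simp only [hP, hN, total_compl, Left.neg_pos_iff]
  have h2 : 𝔼 x, P x + 𝔼 x, N x + 𝔼 x, Z x = 1 := by
    rw [← expect_add_distrib, ← expect_add_distrib]
    refine (expect_congr rfl fun x _ => ?_).trans (Fintype.expect_const 1)
    simp only [hP, hN, hZ]
    rcases lt_trichotomy (total x) 0 with h | h | h
    · simp [h, h.not_gt, h.ne]
    · simp [h]
    · simp [h, h.not_gt, h.ne']
  have h3 : 2 * 𝔼 x, Z x ≤ 1 := by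
    have h := expect_flip ⟨0, hn⟩ Z
    calc 2 * 𝔼 x, Z x = 𝔼 x, (Z x + Z (flip ⟨0, hn⟩ x)) := by
          rw [expect_add_distrib, h, two_mul]
      _ ≤ 1 := expect_le univ_nonempty fun x _ => by
        simp only [hZ, total_flip]
        have hs := sgn_sq ⟨0, hn⟩ x
        split_ifs with h4 h5
        · rw [h4] at h5
          have : sgn ⟨0, hn⟩ x = 0 := by linarith
          rw [this] at hs
          norm_num at hs
        all_goals norm_num
  have h4 : 0 ≤ 𝔼 x, Z x := expect_nonneg fun x _ => by
    simp only [hZ]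
    split_ifs <;> norm_num
  rw [hmu]
  constructor <;> linarith

theorem ind_majority_comp_perm (σ : Equiv.Perm (Fin n)) (x : Cube n) :
    ind (majority n) (x ∘ σ) = ind (majority n) x := by
  simp only [ind, mem_majority, total_comp_perm]

/-- The centred majority indicator has mean zero, so `a` may be subtracted from `q`; both factors
then change sign at the middle layer, and the centred indicator is at least `1/4` in absolute value.
-/
theorem cov_majority_ge {A : Finset (Cube n)} (hn : 0 < n) {a : ℝ}
    (h0 : ∀ x, total x ≤ 0 → symmetrize (ind A) x ≤ a)
    (h1 : ∀ x, 0 < total x → a ≤ symmetrize (ind A) x) :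
    1 / 4 * 𝔼 x, |symmetrize (ind A) x - a| ≤ cov A (majority n) := by
  set q := symmetrize (ind A) with hq
  set B := ind (majority n) with hB
  set b := mu (majority n) with hb
  obtain ⟨hb1, hb2⟩ := mu_majority_mem_Icc hn
  have hbE : 𝔼 x, B x = b := (mu_eq_expect _).symm
  have hcov : cov A (majority n) = 𝔼 x, (q x - a) * (B x - b) := by
    have e1 : cov A (majority n) = 𝔼 x, ind A x * (B x - b) := by
      rw [cov, mu_eq_expect (A ∩ _), mu_eq_expect A, ← hb, expect_mul, ← expect_sub_distrib]
      refine expect_congr rfl fun x _ => ?_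
      have : ind (A ∩ majority n) x = ind A x * B x := by
        simp only [hB, ind, mem_inter]
        split_ifs <;> simp_all
      rw [this]
      ring
    have e2 : 𝔼 x, (B x - b) = 0 := by
      rw [expect_sub_distrib, hbE, Fintype.expect_const, sub_self]
    have e3 := expect_symmetrize_mul (ind A) (fun x => B x - b)
      fun σ x => by rw [hB, ind_majority_comp_perm]
    simp only [sub_mul _ a]
    rw [expect_sub_distrib, ← mul_expect, e2, e1, ← e3]
    ring
  rw [hcov, mul_expect]
  refine expect_le_expect fun x _ => ?_
  rcases le_or_gt (total x) 0 with h | h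
  · have hBx : B x = 0 := by simp [hB, ind, mem_majority, h]
    have := h0 x h
    rw [abs_of_nonpos (by linarith), hBx]
    nlinarith
  · have hBx : B x = 1 := by simp [hB, ind, mem_majority, h]
    have := h1 x h
    rw [abs_of_nonneg (by linarith), hBx]
    nlinarith

/-! ### First moment of `total` and its Gaussian tail -/

theorem expect_ind_mul_total {A : Finset (Cube n)} (hA : IsIncreasing A) :
    𝔼 x, ind A x * total x = 1 / 2 * ∑ i, influence i A := by
  simp only [total, mul_sum]
  rw [expect_sum_comm]
  refine sum_congr rfl fun i _ => ?_
  have h := expect_flip i fun x => ind A x * sgn i x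
  simp only [sgn_flip_same] at h
  have h2 : 𝔼 x, ind A x * sgn i x + 𝔼 x, ind A (flip i x) * -sgn i x = influence i A := by
    rw [← expect_add_distrib, influence_eq_expect]
    refine expect_congr rfl fun x _ => ?_
    -- Monotonicity makes the discrete derivative, where nonzero, have the sign of `sgn i x`.
    have key : (x ∈ A → flip i x ∉ A → x i = true) ∧ (x ∉ A → flip i x ∈ A → x i = false) := by
      constructor
      · intro h1 h2
        by_contra h3
        refine h2 (hA (fun j => ?_) h1)
        rcases eq_or_ne j i with rfl | hj
        · rw [Bool.eq_false_iff.2 h3]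
          exact Bool.false_le _
        · rw [flip_of_ne hj]
      · intro h1 h2
        by_contra h3
        refine h1 (hA (fun j => ?_) h2)
        rcases eq_or_ne j i with rfl | hj
        · rw [Bool.eq_true_of_not_eq_false h3]
          exact Bool.le_true _
        · rw [flip_of_ne hj]
    unfold ind sgn
    by_cases h1 : x ∈ A <;> by_cases h2 : flip i x ∈ A
    · simp [h1, h2]
    · simp [h1, h2, key.1 h1 h2]
    · simp [h1, h2, key.2 h1 h2]
    · simp [h1, h2]
  linarith

theorem expect_exp_mul_total_le (t : ℝ) :
    𝔼 x : Cube n, Real.exp (t * total x) ≤ Real.exp (n * (t ^ 2 / 2)) := by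
  have h : 𝔼 x : Cube n, Real.exp (t * total x) = Real.cosh t ^ n := by
    rw [Fintype.expect_eq_sum_div_card]
    have h1 (x : Cube n) : Real.exp (t * total x)
        = ∏ i, (fun (_ : Fin n) (b : Bool) => Real.exp (t * if b then 1 else -1)) i (x i) := by
      rw [total, mul_sum, Real.exp_sum]
      rfl
    simp only [h1]
    rw [← Fintype.prod_sum fun (_ : Fin n) (b : Bool) => Real.exp (t * if b then 1 else -1)]
    simp only [Fintype.sum_bool, prod_const, card_univ, Fintype.card_fin]
    rw [Real.cosh_eq, div_pow]
    simp
  rw [h, Real.exp_nat_mul]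
  exact pow_le_pow_left₀ (Real.cosh_pos t).le (Real.cosh_le_exp_half_sq t) n

/-- A first moment against `|total|` is controlled by the plain mean, up to a Gaussian tail. -/
theorem expect_mul_abs_total_le (hn : 0 < n) {g : Cube n → ℝ} (hg0 : ∀ x, 0 ≤ g x)
    (hg1 : ∀ x, g x ≤ 1) {M : ℝ} (hM : 0 ≤ M) :
    𝔼 x, g x * |total x| ≤ M * 𝔼 x, g x + 2 * n * Real.exp (-(M ^ 2 / (2 * n))) := by
  have hnR : (0 : ℝ) < n := Nat.cast_pos.2 hn
  -- This `t` minimises the Chernoff exponent `n * t ^ 2 / 2 - t * M`.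
  set t := M / n with ht
  have ht0 : 0 ≤ t := by positivity
  have hpt (x : Cube n) : g x * |total x| ≤ M * g x
      + n * Real.exp (-(t * M)) * (Real.exp (t * total x) + Real.exp (-t * total x)) := by
    rcases le_or_gt |total x| M with h | h
    · have := mul_le_mul_of_nonneg_left h (hg0 x)
      have : 0 ≤ n * Real.exp (-(t * M)) * (Real.exp (t * total x) + Real.exp (-t * total x)) := by
        positivity
      linarith
    · have h1 : g x * |total x| ≤ n := by
        calc g x * |total x| ≤ 1 * n :=
              mul_le_mul (hg1 x) (abs_total_le x) (abs_nonneg _) zero_le_one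
          _ = n := one_mul _
      have h2 : Real.exp (t * M) ≤ Real.exp (t * total x) + Real.exp (-t * total x) := by
        have h3 : Real.exp (t * M) ≤ Real.exp (t * |total x|) :=
          Real.exp_le_exp.2 (mul_le_mul_of_nonneg_left h.le ht0)
        have h4 := Real.exp_pos (t * total x)
        have h5 := Real.exp_pos (-t * total x)
        rcases abs_choice (total x) with h6 | h6
        · rw [h6] at h3
          linarith
        · rw [h6, mul_neg, ← neg_mul] at h3
          linarith
      have h7 : 1 ≤ Real.exp (-(t * M)) * (Real.exp (t * total x) + Real.exp (-t * total x)) := by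
        calc 1 = Real.exp (-(t * M)) * Real.exp (t * M) := by rw [← Real.exp_add]; simp
          _ ≤ _ := mul_le_mul_of_nonneg_left h2 (Real.exp_pos _).le
      have h8 := mul_le_mul_of_nonneg_left h7 hnR.le
      have h9 := mul_nonneg hM (hg0 x)
      linarith
  have hexp : Real.exp (-(t * M)) * Real.exp (n * (t ^ 2 / 2))
      = Real.exp (-(M ^ 2 / (2 * n))) := by
    rw [← Real.exp_add, ht]
    congr 1
    field_simp
    ring
  calc 𝔼 x, g x * |total x| ≤ 𝔼 x, (M * g x
        + n * Real.exp (-(t * M)) * (Real.exp (t * total x) + Real.exp (-t * total x))) :=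
        expect_le_expect fun x _ => hpt x
    _ = M * 𝔼 x, g x + n * Real.exp (-(t * M)) *
        (𝔼 x : Cube n, Real.exp (t * total x) + 𝔼 x : Cube n, Real.exp (-t * total x)) := by
        simp only [expect_add_distrib, ← mul_expect]
    _ ≤ M * 𝔼 x, g x + n * Real.exp (-(t * M)) *
        (Real.exp (n * (t ^ 2 / 2)) + Real.exp (n * (t ^ 2 / 2))) := by
        have h1 := expect_exp_mul_total_le (n := n) t
        have h2 := expect_exp_mul_total_le (n := n) (-t)
        rw [neg_sq] at h2
        gcongr
    _ = _ := by
        rw [← hexp]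
        ring

theorem total_influence_le {A : Finset (Cube n)} (hA : IsIncreasing A) (hn : 0 < n) {M : ℝ}
    (hM : 0 ≤ M) : ∑ i, influence i A
      ≤ 8 * M * cov A (majority n) + 4 * n * Real.exp (-(M ^ 2 / (2 * n))) := by
  obtain ⟨a, ⟨ha0, ha1⟩, h0, h1⟩ := exists_threshold hA
  have hcov := cov_majority_ge hn h0 h1
  have hqa (x : Cube n) : (symmetrize (ind A) x - a) * total x
      = |symmetrize (ind A) x - a| * |total x| := by
    rw [← abs_mul, abs_of_nonneg]
    rcases le_or_gt (total x) 0 with h | h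
    · exact mul_nonneg_of_nonpos_of_nonpos (sub_nonpos.2 (h0 x h)) h
    · exact mul_nonneg (sub_nonneg.2 (h1 x h)) h.le
  have hI : 1 / 2 * ∑ i, influence i A = 𝔼 x, |symmetrize (ind A) x - a| * |total x| := by
    rw [← expect_ind_mul_total hA, ← expect_symmetrize_mul _ _ total_comp_perm]
    simp only [← hqa, sub_mul]
    rw [expect_sub_distrib, ← mul_expect, expect_total, mul_zero, sub_zero]
  have htail := expect_mul_abs_total_le hn (g := fun x => |symmetrize (ind A) x - a|)
    (fun x => abs_nonneg _) (fun x => by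
      obtain ⟨hq0, hq1⟩ := symmetrize_ind_mem_Icc A x
      rw [abs_le]
      constructor <;> linarith) hM
  have := mul_le_mul_of_nonneg_left hcov hM
  linarith

theorem cov_majority_nonneg {A : Finset (Cube n)} (hA : IsIncreasing A) (hn : 0 < n) :
    0 ≤ cov A (majority n) := by
  obtain ⟨a, -, h0, h1⟩ := exists_threshold hA
  refine le_trans ?_ (cov_majority_ge hn h0 h1)
  exact mul_nonneg (by norm_num) (expect_nonneg fun x _ => abs_nonneg _)

end DiscreteCube

/-! ### Choice of `M` and conclusion -/

theorem mainTheorem4 :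
    ∃ c : ℝ, 0 < c ∧
      ∀ (n : ℕ) (A : Finset (DiscreteCube.Cube n)),
        DiscreteCube.IsIncreasing A → DiscreteCube.IsRegular A → DiscreteCube.IsBalanced A →
          c * (Real.sqrt (Real.log n) / Real.sqrt n) ≤
            DiscreteCube.cov A (DiscreteCube.majority n) := by
  -- `1248 = 8 * 6 * 26`: the `8` of `total_influence_le`, `M = 6 * (u * v)`, and the `L / 26` left
  -- after the tail takes half of `L / 13`.
  refine ⟨1 / 1248, by norm_num, fun n A hA hr hb => ?_⟩
  rcases Nat.eq_zero_or_pos n with rfl | hn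
  · have h : (A.card : ℝ) / 2 ^ 0 = 1 / 2 := hb
    rw [pow_zero, div_one, eq_div_iff two_ne_zero] at h
    have h' : A.card * 2 = 1 := by exact_mod_cast h
    omega
  rcases (Nat.succ_le_of_lt hn).eq_or_lt with h1 | h2
  -- Here `log 1 = 0`, so nonnegativity suffices.
  · subst h1
    simpa using DiscreteCube.cov_majority_nonneg hA hn
  have hnR : (2 : ℝ) ≤ n := by exact_mod_cast h2
  have hlog2 : (1 / 2 : ℝ) < Real.log n :=
    (by linarith [Real.log_two_gt_d9] : (1 / 2 : ℝ) < Real.log 2).trans_le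
      (Real.log_le_log (by norm_num) hnR)
  set L := Real.log n with hL
  set u := Real.sqrt L with hu
  set v := Real.sqrt n with hv
  have hu2 : u ^ 2 = L := Real.sq_sqrt (by linarith)
  have hv2 : v ^ 2 = n := Real.sq_sqrt (by linarith)
  have hu0 : 0 < u := Real.sqrt_pos.2 (by linarith)
  have hv0 : 0 < v := Real.sqrt_pos.2 (by linarith)
  have hkkl := DiscreteCube.log_le_total_influence A hr hb
  have hcov := DiscreteCube.total_influence_le hA hn (M := 6 * (u * v)) (by positivity)
  -- With this `M` the exponential is `n ^ (-18)`, so the tail is at most `4 / 2 ^ 17`.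
  have htail : 4 * n * Real.exp (-((6 * (u * v)) ^ 2 / (2 * n))) ≤ L / 26 := by
    have h3 : (6 * (u * v)) ^ 2 / (2 * n) = (18 : ℕ) * L := by
      rw [mul_pow, mul_pow, hu2, hv2]
      field_simp
      norm_num
    rw [h3, Real.exp_neg, Real.exp_nat_mul, hL, Real.exp_log (by linarith), ← hL]
    have h4 : (2 : ℝ) ^ 17 ≤ (n : ℝ) ^ 17 := pow_le_pow_left₀ (by norm_num) hnR 17
    have h5 : 4 * (n : ℝ) * ((n : ℝ) ^ 18)⁻¹ = 4 / (n : ℝ) ^ 17 := by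
      field_simp
    rw [h5]
    calc 4 / (n : ℝ) ^ 17 ≤ 4 / 2 ^ 17 := div_le_div_of_nonneg_left (by norm_num) (by norm_num) h4
      _ ≤ L / 26 := by linarith
  have h6 : u ^ 2 ≤ 1248 * (u * v) * DiscreteCube.cov A (DiscreteCube.majority n) := by
    rw [hu2]
    linarith
  have h7 : u ≤ 1248 * v * DiscreteCube.cov A (DiscreteCube.majority n) := by
    refine le_of_mul_le_mul_left ?_ hu0
    linarith
  rw [← mul_div_assoc, div_le_iff₀ hv0]
  linarith
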